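/- Graphs are finite, simple, undirected, unlabeled, with vertex set $[n]=\{1,\dots,n\}$ ($n$-order graphs), and are identified with their adjacency matrices; $\mathfrak{A}_n$ denotes the set of all of them. A property holds for almost all graphs (in the sense of Babai, Erdős and Selkow) if it fails for only $o(2^{\binom n2})$ of the $2^{\binom n2}$ graphs on $[n]$ as $n\to\infty$. A function $f\colon\mathfrak{A}_n\to\mathbb{R}^d$ is permutation-invariant if it takes equal values on adjacency matrices that differ by a simultaneous permutation of rows and columns, and it is 1-WL-equivalent if, for all $A,B\in\mathfrak{A}_n$, $f(A)\neq f(B)$ exactly when the 1-dimensional Weisfeiler–Leman algorithm (color refinement started from the constant coloring) distinguishes $A$ and $B$. An upstream MPNN assigns to each graph $G$ symmetric priors $\theta(G)\in\mathbb{R}^{n\times n}$ as follows: $h_v^{(0)}=(1,\dots,1)\in\mathbb{R}^m$, $h_v^{(t)}=\mathsf{UPD}^{(t)}\bigl(h_v^{(t-1)},\mathsf{AGG}^{(t)}(\{\!\{h_u^{(t-1)}: u\in N(v)\}\!\})\bigr)\in\mathbb{R}^m$ for $1\le t\le T$, and $\theta(G)_{ij}=\phi(\{\!\{h_i^{(T)},h_j^{(T)}\}\!\})$,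 where $m\geq 1$, $T\ge 0$ and the functions $\mathsf{UPD}^{(t)}$, $\mathsf{AGG}^{(t)}$, $\phi$ are arbitrary and do not depend on $G$. For $\theta\in\mathbb{R}^{n\times n}$ put $p_\theta(S)=\prod_{i,j=1}^n p_{\theta_{ij}}(S_{ij})$ with $p_{\theta_{ij}}(1)=\mathrm{sigmoid}(\theta_{ij})$ and $p_{\theta_{ij}}(0)=1-\mathrm{sigmoid}(\theta_{ij})$. For a graph $C$ of candidate edges and $k\le|E(C)|$, the exactly-$k$ distribution $p^{C}_{(\theta,k)}$ is $p_\theta$ conditioned on the set of graphs $S$ on $[n]$ that have exactly $k$ edges, all of them in $C$. **Theorem.** For every fixed $k$, almost all graphs have at least $k$ edges. Moreover, almost all graphs $G$ have the following property, where $n$ denotes the order of $G$. For every $\varepsilon\in(0,1)$, every $k$ with $0<k\le|E(G)|$, every graph $H$ on $[n]$ isomorphic to $G$, every $d>0$ and every permutation-invariant, 1-WL-equivalent function $f\colon\mathfrak{A}_n\to\mathbb{R}^d$, there is an upstream MPNN, with priors $\theta(\cdot)$, such that the exactly-$k$ distribution, used to remove edges, separates $G$ and $H$ with probability at most $\varepsilon$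 with respect to $f$. That is, for independent $S\sim p_{(\theta(G),k)}$ and $T\sim p_{(\theta(H),k)}$, $$\Pr\bigl[f(G\setminus S)\neq f(H\setminus T)\bigr]\le\varepsilon ,$$ where $G\setminus S$ is $G$ with the edges of $S$ deleted. The same MPNN achieves this bound for both conventions for the candidate edges: when the $k$ edges are sampled among the edges of the input graph ($C=G$ for $S$ and $C=H$ for $T$), and when they are sampled among all vertex pairs ($C$ complete for both). -/

import Mathlib

open Filter Topology

noncomputable section

namespace PRMPNN

/-- The type of colors of iteration `t` of the 1-dimensional Weisfeiler-Leman algorithm on unlabeled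
graphs. The pair (old color, multiset of the old colors of the neighbors) is itself used as the
new color, which is an injective relabeling common to all graphs. -/
def WLColor : ℕ → Type
  | 0 => Unit
  | t + 1 => WLColor t × Multiset (WLColor t)

open Classical in
/-- The 1-WL coloring of the vertices of `G` after `t` iterations. -/
def wlColoring {n : ℕ} (G : SimpleGraph (Fin n)) : (t : ℕ) → Fin n → WLColor t
  | 0 => fun _ => ()
  | t + 1 => fun v => (wlColoring G t v, (G.neighborFinset v).val.map (wlColoring G t))

/-- 1-WL, run in parallel on `G` and `H`, distinguishes them: at some iteration some color occurs
a different number of times. -/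
def WLDistinguishes {n : ℕ} (G H : SimpleGraph (Fin n)) : Prop :=
  ∃ (t : ℕ) (c : WLColor t),
    {v | wlColoring G t v = c}.ncard ≠ {v | wlColoring H t v = c}.ncard

/-- A function on `n`-order graphs is 1-WL-equivalent if it takes different values on exactly those
pairs of graphs that 1-WL distinguishes. -/
def WLEquivalent {n d : ℕ} (f : SimpleGraph (Fin n) → EuclideanSpace ℝ (Fin d)) : Prop :=
  ∀ G H : SimpleGraph (Fin n), f G = f H ↔ ¬ WLDistinguishes G H

/-- Invariance under renaming the vertices, i.e. under simultaneous permutations of the rows and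
columns of the adjacency matrix. -/
def PermInvariant {n d : ℕ} (f : SimpleGraph (Fin n) → EuclideanSpace ℝ (Fin d)) : Prop :=
  ∀ (σ : Equiv.Perm (Fin n)) (G : SimpleGraph (Fin n)), f (G.comap σ) = f G

/-- An upstream message-passing graph neural network of width `m`: in layer `t` every vertex
updates its feature by `upd t` from its old feature and from the aggregate `agg t` of the multiset
of its neighbors' features. After `depth` layers, the prior of a vertex pair is read off from the
unordered pair of the two features. -/
structure UpstreamMPNN (m : ℕ) where
  depth : ℕ
  upd : ℕ → EuclideanSpace ℝ (Fin m) → EuclideanSpace ℝ (Fin m) → EuclideanSpace ℝ (Fin m)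
  agg : ℕ → Multiset (EuclideanSpace ℝ (Fin m)) → EuclideanSpace ℝ (Fin m)
  edgeReadout : Sym2 (EuclideanSpace ℝ (Fin m)) → ℝ

namespace UpstreamMPNN

open Classical in
/-- Vertex features after `t` layers. As the graphs carry no attributes, all initial features
are the all-ones vector. -/
def feature {m n : ℕ} (U : UpstreamMPNN m) (G : SimpleGraph (Fin n)) :
    ℕ → Fin n → EuclideanSpace ℝ (Fin m)
  | 0 => fun _ => WithLp.toLp 2 (fun _ => 1)
  | t + 1 => fun v =>
      U.upd (t + 1) (U.feature G t v)
        (U.agg (t + 1) ((G.neighborFinset v).val.map (U.feature G t)))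

/-- The matrix `θ` of (unnormalized) priors computed from the graph `G`. -/
def priors {m n : ℕ} (U : UpstreamMPNN m) (G : SimpleGraph (Fin n)) : Fin n → Fin n → ℝ :=
  fun i j => U.edgeReadout s(U.feature G U.depth i, U.feature G U.depth j)

end UpstreamMPNN

open Classical in
/-- The unconstrained product weight `p_θ(A(S)) = ∏_{i,j} p_{θ_ij}(A(S)_ij)`, with
`p_{θ_ij}(1) = sigmoid θ_ij` and `p_{θ_ij}(0) = 1 - sigmoid θ_ij`. -/
def edgeWeight {n : ℕ} (θ : Fin n → Fin n → ℝ) (S : SimpleGraph (Fin n)) : ℝ :=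
  ∏ i, ∏ j, if S.Adj i j then Real.sigmoid (θ i j) else 1 - Real.sigmoid (θ i j)

open Classical in
/-- The exactly-`k` probability mass function `p_(θ,k)`: the weight `p_θ` conditioned on having
exactly `k` edges, all of them in the graph `C` of candidate edges. For `C = ⊤` it is supported on
all `k`-edge graphs on the vertex set; for `C = G` on the `k`-element sets of edges of `G`. -/
def exactlyK {n : ℕ} (C : SimpleGraph (Fin n)) (θ : Fin n → Fin n → ℝ) (k : ℕ)
    (S : SimpleGraph (Fin n)) : ℝ :=
  if S ≤ C ∧ S.edgeSet.ncard = k then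
    edgeWeight θ S / ∑ B : SimpleGraph (Fin n) with B ≤ C ∧ B.edgeSet.ncard = k, edgeWeight θ B
  else 0

open Classical in
/-- The probability that `f (G \ S) ≠ f (H \ T)` (removal of the sampled edges) for independent
samples `S` and `T` with probability mass functions `p` and `q`. -/
def separationProb {n d : ℕ} (f : SimpleGraph (Fin n) → EuclideanSpace ℝ (Fin d))
    (G H : SimpleGraph (Fin n)) (p q : SimpleGraph (Fin n) → ℝ) : ℝ :=
  ∑ S, ∑ T, p S * q T * (if f (G \ S) ≠ f (H \ T) then 1 else 0)

/-- `P` holds for almost all graphs: for all but `o(2^(n choose 2))` of the `2^(n choose 2)` graphs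
on `n` labeled vertices. -/
def AlmostAllGraphs (P : (n : ℕ) → SimpleGraph (Fin n) → Prop) : Prop :=
  Tendsto (fun n : ℕ => ({G : SimpleGraph (Fin n) | ¬ P n G}.ncard : ℝ) / 2 ^ (n.choose 2))
    atTop (𝓝 0)

end PRMPNN

end

/-! In almost every graph, two rounds of color refinement give all vertices different colors: the
multisets of neighbor degrees are pairwise distinct (`almostAllGraphs_neighborDegreesSeparate`). A
message-passing network that encodes multisets injectively then has pairwise distinct features on
`G`, so its readout can single out any chosen set `S` of `k` edges. With priors `M` on `S` and `-M`
elsewhere, the exactly-`k` distribution concentrates on `S` as `M → ∞`, for either set of candidate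
edges. By equivariance the same network concentrates on the copy `T` of `S` in `H`. As `G \ S` and
`H \ T` are isomorphic, `f` agrees on them, and the separation probability tends to 0
(`exists_mpnn_separationProb_le`).

For the random graph statement, fix `u ≠ v` and consider the vertices adjacent to exactly one of
them. There are many (`ncard_card_exclusiveNeighbors_lt_le`), and no degree is shared by many
vertices (`ncard_degree_eq_le`), so they fall into many degree classes. Equal multisets force `u` to
be adjacent to exactly half of each class, but exchanging the roles of `u` and `v` at any of these
vertices preserves their degrees; hence `L` classes cost a factor `2 ^ (-L)`
(`ncard_map_degree_eq_le`). All three estimates average over a family of bijections of the set of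
graphs, and a union bound concludes. -/

noncomputable section

namespace PRMPNN

open Finset
open scoped symmDiff

/-! ### Averaging over families of bijections -/

section Averaging

lemma ncard_le_card_of_subset {α : Type*} {s : Set α} {t : Finset α} (h : s ⊆ ↑t) :
    s.ncard ≤ #t :=
  (Set.ncard_le_ncard h t.finite_toSet).trans_eq (Set.ncard_coe_finset t)

/-- If every member of a family of bijections is applied to `ω` and, for every fixed `ω`, at most a
proportion `p` of the parameters lead into `P`, then at most a proportion `p` of all points is
in `P`. -/
lemma ncard_le_of_bijective_family {Ω X : Type*} [Finite Ω] [Finite X] [Nonempty X]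
    (P : Ω → Prop) (act : X → Ω → Ω) (hact : ∀ x, Function.Bijective (act x)) (p : ℝ)
    (h : ∀ ω, ({x | P (act x ω)}.ncard : ℝ) ≤ p * Nat.card X) :
    ({ω | P ω}.ncard : ℝ) ≤ p * Nat.card Ω := by
  classical
  have := Fintype.ofFinite Ω
  have := Fintype.ofFinite X
  have hX : (0 : ℝ) < Nat.card X := by exact_mod_cast Nat.card_pos
  have hΩ : ∀ Q : Ω → Prop, {ω | Q ω}.ncard = #{ω | Q ω} := fun Q => by
    rw [← Set.ncard_coe_finset, coe_filter_univ]
  have hX' : ∀ Q : X → Prop, {ω | Q ω}.ncard = #{ω | Q ω} := fun Q => by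
    rw [← Set.ncard_coe_finset, coe_filter_univ]
  have h1 : ∀ x, #{ω | P (act x ω)} = #{ω | P ω} := by
    intro x
    refine Finset.card_bij (fun ω _ => act x ω) ?_ ?_ ?_
    · intro ω hω; simpa using hω
    · intro a _ b _ hab; exact (hact x).1 hab
    · intro b hb
      obtain ⟨a, rfl⟩ := (hact x).2 b
      exact ⟨a, by simpa using hb, rfl⟩
  have h2 : ∑ x : X, #{ω | P (act x ω)} = ∑ ω : Ω, #{x | P (act x ω)} := by
    simp only [Finset.card_filter]
    exact Finset.sum_comm
  have h3 : (Nat.card X : ℝ) * #{ω | P ω} ≤ Nat.card Ω * (p * Nat.card X) := by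
    calc (Nat.card X : ℝ) * #{ω | P ω} = ((∑ x : X, #{ω | P (act x ω)} : ℕ) : ℝ) := by
          simp [h1, Nat.card_eq_fintype_card]
      _ = ∑ ω : Ω, (#{x | P (act x ω)} : ℝ) := by rw [h2]; push_cast; rfl
      _ ≤ ∑ ω : Ω, p * Nat.card X := Finset.sum_le_sum fun ω _ => by rw [← hX']; exact h ω
      _ = _ := by simp [Nat.card_eq_fintype_card]
  rw [hΩ]
  nlinarith

end Averaging

/-! ### Bounds on binomial coefficients -/

section Binomial

/-- The factor `2 * m + 1` lets the induction close: the step reduces to `(2m+1)(2m+3) ≤ 4(m+1)²`.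
-/
lemma centralBinom_sq_mul_le (m : ℕ) : m.centralBinom ^ 2 * (2 * m + 1) ≤ 16 ^ m := by
  induction m with
  | zero => simp
  | succ m ih =>
    have h := Nat.succ_mul_centralBinom_succ m
    have key : (m + 1) ^ 2 * ((m + 1).centralBinom ^ 2 * (2 * (m + 1) + 1)) ≤
        (m + 1) ^ 2 * 16 ^ (m + 1) := by
      calc (m + 1) ^ 2 * ((m + 1).centralBinom ^ 2 * (2 * (m + 1) + 1))
          = ((m + 1) * (m + 1).centralBinom) ^ 2 * (2 * m + 3) := by ring
        _ = (m.centralBinom ^ 2 * (2 * m + 1)) * (4 * ((2 * m + 1) * (2 * m + 3))) := by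
          rw [h]; ring
        _ ≤ 16 ^ m * (4 * (4 * (m + 1) ^ 2)) := by
          refine Nat.mul_le_mul ih ?_
          nlinarith
        _ = _ := by ring
    exact Nat.le_of_mul_le_mul_left key (by positivity)

lemma choose_sq_mul_le (N j : ℕ) : N.choose j ^ 2 * N ≤ 4 ^ N := by
  obtain ⟨m, rfl | rfl⟩ := N.even_or_odd'
  · calc (2 * m).choose j ^ 2 * (2 * m) ≤ m.centralBinom ^ 2 * (2 * m + 1) := by
          gcongr
          · exact Nat.choose_le_centralBinom j m
          · omega
      _ ≤ 16 ^ m := centralBinom_sq_mul_le m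
      _ = _ := by rw [pow_mul]; norm_num
  · have h : (2 * m + 1).choose j ≤ 2 * m.centralBinom := by
      cases j with
      | zero => have := Nat.centralBinom_pos m; simp; omega
      | succ j =>
        rw [Nat.choose_succ_succ]
        have := Nat.choose_le_centralBinom j m
        have := Nat.choose_le_centralBinom (j + 1) m
        simp only [Nat.succ_eq_add_one]
        omega
    calc (2 * m + 1).choose j ^ 2 * (2 * m + 1)
        ≤ (2 * m.centralBinom) ^ 2 * (2 * m + 1) := by gcongr
      _ = 4 * (m.centralBinom ^ 2 * (2 * m + 1)) := by ring
      _ ≤ 4 * 16 ^ m := by gcongr; exact centralBinom_sq_mul_le m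
      _ = _ := by rw [pow_succ, pow_mul]; norm_num; ring

lemma choose_le_two_pow_div_sqrt (N j : ℕ) (hN : 0 < N) :
    (N.choose j : ℝ) ≤ 2 ^ N / √N := by
  have hN' : (0 : ℝ) < N := by exact_mod_cast hN
  rw [le_div_iff₀ (Real.sqrt_pos.2 hN')]
  refine le_of_sq_le_sq ?_ (by positivity)
  rw [mul_pow, Real.sq_sqrt hN'.le, ← pow_mul, mul_comm N 2, pow_mul]
  have := choose_sq_mul_le N j
  norm_num
  exact_mod_cast this

/-- The number of sets with fewer than `s` elements. -/
lemma card_filter_card_lt_le {V : Type*} [Fintype V] [Nonempty V] (s : ℕ) :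
    #{y : Finset V | #y < s} ≤ s * Fintype.card V ^ s := by
  classical
  have h : ({y : Finset V | #y < s} : Finset (Finset V)) ⊆
      (range s).biUnion fun j => powersetCard j univ := by
    intro y hy
    simpa [mem_powersetCard] using hy
  calc _ ≤ _ := card_le_card h
    _ ≤ ∑ j ∈ range s, #(powersetCard j (univ : Finset V)) := card_biUnion_le
    _ ≤ ∑ j ∈ range s, Fintype.card V ^ s := by
      refine sum_le_sum fun j hj => ?_
      rw [card_powersetCard, card_univ]
      exact (Nat.choose_le_pow _ _).trans
        (Nat.pow_le_pow_right Fintype.card_pos (mem_range.1 hj).le)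
    _ = _ := by simp

end Binomial

/-! ### The number of labeled graphs -/

section Counting

lemma card_simpleGraph_le (n : ℕ) :
    Nat.card (SimpleGraph (Fin n)) ≤ 2 ^ n.choose 2 := by
  classical
  have hinj : Function.Injective (fun G : SimpleGraph (Fin n) =>
      ({e | (e : Sym2 (Fin n)) ∈ G.edgeSet} : Set {e : Sym2 (Fin n) // ¬ e.IsDiag})) := by
    intro G H h
    apply SimpleGraph.edgeSet_injective
    ext e
    by_cases he : e.IsDiag
    · exact iff_of_false (fun h' => G.not_isDiag_of_mem_edgeSet h' he)
        (fun h' => H.not_isDiag_of_mem_edgeSet h' he)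
    · exact Set.ext_iff.1 h ⟨e, he⟩
  refine (Nat.card_le_card_of_injective _ hinj).trans ?_
  rw [Nat.card_eq_fintype_card, Fintype.card_set, Sym2.card_subtype_not_diag, Fintype.card_fin]

end Counting

open Classical in
/-- Vertices are determined by the multiset of the degrees of their neighbors. -/
def NeighborDegreesSeparate {n : ℕ} (G : SimpleGraph (Fin n)) : Prop :=
  Function.Injective fun v => (G.neighborFinset v).val.map fun w => G.degree w

/-! ### Networks with injective aggregation -/

section MPNN

/-- An infinite type has as many finite multisets as elements. Since aggregation is arbitrary, width
1 therefore suffices. -/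
lemma exists_injective_multiset (E : Type*) [Infinite E] :
    ∃ g : Multiset E → E, Function.Injective g := by
  have h : Cardinal.mk (Multiset E) ≤ Cardinal.mk E := (Cardinal.mk_multiset_of_infinite E).le
  obtain ⟨g⟩ := Cardinal.le_def _ _ |>.1 h
  exact ⟨g, g.injective⟩

/-- The two-layer network whose layers encode the multiset of the neighbors' features by `g`. -/
def twoLayerMPNN (g : Multiset (EuclideanSpace ℝ (Fin 1)) → EuclideanSpace ℝ (Fin 1))
    (r : Sym2 (EuclideanSpace ℝ (Fin 1)) → ℝ) : UpstreamMPNN 1 where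
  depth := 2
  upd := fun _ _ a => a
  agg := fun _ => g
  edgeReadout := r

/-- The first layer encodes the degree, because all initial features coincide; the second encodes
the multiset of neighbor degrees. -/
lemma feature_injective {n : ℕ} {G : SimpleGraph (Fin n)} (hG : NeighborDegreesSeparate G)
    {g : Multiset (EuclideanSpace ℝ (Fin 1)) → EuclideanSpace ℝ (Fin 1)}
    (hg : Function.Injective g) (r : Sym2 (EuclideanSpace ℝ (Fin 1)) → ℝ) :
    Function.Injective ((twoLayerMPNN g r).feature G 2) := by
  classical
  set c : ℕ → EuclideanSpace ℝ (Fin 1) :=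
    fun k => g (Multiset.replicate k (WithLp.toLp 2 (fun _ => 1))) with hc
  have hcinj : Function.Injective c := by
    intro a b hab
    have := congrArg Multiset.card (hg hab)
    simpa using this
  have h1 : (twoLayerMPNN g r).feature G 1 = fun v => c (G.degree v) := by
    funext v
    simp only [UpstreamMPNN.feature, twoLayerMPNN, hc, Multiset.map_const']
    congr 2
  intro u v huv
  apply hG
  have h2 : (G.neighborFinset u).val.map ((twoLayerMPNN g r).feature G 1) =
      (G.neighborFinset v).val.map ((twoLayerMPNN g r).feature G 1) := by
    have : g _ = g _ := huv
    convert hg this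
  apply Multiset.map_injective hcinj
  simp only [Multiset.map_map, Function.comp_def]
  rw [h1] at h2
  convert h2

lemma feature_iso {m n : ℕ} (U : UpstreamMPNN m) {G H : SimpleGraph (Fin n)} (σ : G ≃g H)
    (t : ℕ) (v : Fin n) : U.feature H t (σ v) = U.feature G t v := by
  classical
  induction t generalizing v with
  | zero => rfl
  | succ t ih =>
    simp only [UpstreamMPNN.feature, ih]
    congr 2
    have h : H.neighborFinset (σ v) = (G.neighborFinset v).map σ.toEquiv.toEmbedding := by
      ext w
      obtain ⟨w, rfl⟩ := σ.surjective w
      simp only [SimpleGraph.mem_neighborFinset, Finset.mem_map, Equiv.coe_toEmbedding]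
      constructor
      · intro hw
        exact ⟨w, σ.map_adj_iff.1 hw, rfl⟩
      · rintro ⟨a, ha, hae⟩
        have : a = w := σ.injective hae
        subst this
        exact σ.map_adj_iff.2 ha
    have h' : (H.neighborFinset (σ v)).val.map (U.feature H t) =
        (G.neighborFinset v).val.map (U.feature G t) := by
      rw [h, Finset.map_val, Multiset.map_map]
      exact Multiset.map_congr rfl fun w _ => ih w
    convert h'

end MPNN

/-! ### Concentration of the exactly-`k` distribution -/

section Concentration

open Classical in
/-- The priors that are `M` on the edges of `S` and `-M` elsewhere. -/
def sharpPriors {n : ℕ} (S : SimpleGraph (Fin n)) (M : ℝ) : Fin n → Fin n → ℝ :=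
  fun i j => if S.Adj i j then M else -M

open Classical in
lemma tendsto_edgeWeight_sharpPriors {n : ℕ} (S B : SimpleGraph (Fin n)) :
    Tendsto (fun M => edgeWeight (sharpPriors S M) B) atTop (𝓝 (if B = S then 1 else 0)) := by
  have hl : (∏ i, ∏ j, if (B.Adj i j ↔ S.Adj i j) then (1 : ℝ) else 0) =
      if B = S then 1 else 0 := by
    split_ifs with h
    · subst h; simp
    · have : ∃ i j, ¬ (B.Adj i j ↔ S.Adj i j) := by
        by_contra! hc
        exact h (by ext i j; exact hc i j)
      obtain ⟨i, j, hij⟩ := this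
      refine prod_eq_zero (mem_univ i) (prod_eq_zero (mem_univ j) ?_)
      simp [hij]
  rw [← hl]
  unfold edgeWeight
  refine tendsto_finsetProd _ fun i _ => tendsto_finsetProd _ fun j _ => ?_
  have h1 := Real.tendsto_sigmoid_atTop
  have h0 : Tendsto (fun M => 1 - Real.sigmoid M) atTop (𝓝 0) := by
    simpa using h1.const_sub 1
  by_cases hB : B.Adj i j <;> by_cases hS : S.Adj i j <;>
    simp only [sharpPriors, hB, hS, if_true, if_false, Real.sigmoid_neg, sub_sub_cancel, iff_true,
      iff_false, not_true_eq_false] <;> assumption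

open Classical in
-- The graph `S` is itself admissible, so the normalizing sum tends to 1 and division preserves the
-- limits of the weights.
lemma tendsto_exactlyK_sharpPriors {n k : ℕ} {C S : SimpleGraph (Fin n)} (hSC : S ≤ C)
    (hS : S.edgeSet.ncard = k) (B : SimpleGraph (Fin n)) :
    Tendsto (fun M => exactlyK C (sharpPriors S M) k B) atTop (𝓝 (if B = S then 1 else 0)) := by
  unfold exactlyK
  by_cases hB : B ≤ C ∧ B.edgeSet.ncard = k
  · simp only [hB, and_self, if_true]
    have h1 := tendsto_edgeWeight_sharpPriors S B
    have h2 : Tendsto (fun M => ∑ B : SimpleGraph (Fin n) with B ≤ C ∧ B.edgeSet.ncard = k,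
        edgeWeight (sharpPriors S M) B) atTop (𝓝 1) := by
      have := tendsto_finsetSum
        (univ.filter fun B : SimpleGraph (Fin n) => B ≤ C ∧ B.edgeSet.ncard = k)
        fun B _ => tendsto_edgeWeight_sharpPriors S B
      simpa [Finset.sum_ite_eq', hSC, hS] using this
    simpa [Pi.div_def] using h1.div h2 one_ne_zero
  · have : B ≠ S := by rintro rfl; exact hB ⟨hSC, hS⟩
    simp [hB, this]

open Classical in
lemma tendsto_separationProb_sharpPriors {n k d : ℕ}
    (f : SimpleGraph (Fin n) → EuclideanSpace ℝ (Fin d)) {G H C D S T : SimpleGraph (Fin n)}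
    (hSC : S ≤ C) (hS : S.edgeSet.ncard = k) (hTD : T ≤ D) (hT : T.edgeSet.ncard = k)
    (hf : f (G \ S) = f (H \ T)) :
    Tendsto (fun M => separationProb f G H (exactlyK C (sharpPriors S M) k)
      (exactlyK D (sharpPriors T M) k)) atTop (𝓝 0) := by
  unfold separationProb
  have hl : ∑ A : SimpleGraph (Fin n), ∑ B : SimpleGraph (Fin n),
      (if A = S then (1 : ℝ) else 0) * (if B = T then 1 else 0) *
        (if f (G \ A) ≠ f (H \ B) then 1 else 0) = 0 := by
    refine sum_eq_zero fun A _ => sum_eq_zero fun B _ => ?_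
    by_cases hA : A = S
    · by_cases hB : B = T
      · subst hA hB; simp [hf]
      · simp [hB]
    · simp [hA]
  have key := tendsto_finsetSum (univ : Finset (SimpleGraph (Fin n))) fun A _ =>
    tendsto_finsetSum (univ : Finset (SimpleGraph (Fin n))) fun B _ =>
      ((tendsto_exactlyK_sharpPriors hSC hS A).mul
        (tendsto_exactlyK_sharpPriors hTD hT B)).mul_const
          (if f (G \ A) ≠ f (H \ B) then (1 : ℝ) else 0)
  rwa [hl] at key

end Concentration

lemma exists_le_edgeSet_ncard_eq {n k : ℕ} {G : SimpleGraph (Fin n)} (hk : k ≤ G.edgeSet.ncard) :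
    ∃ S ≤ G, S.edgeSet.ncard = k := by
  obtain ⟨t, ht, htk⟩ := Set.exists_subset_card_eq hk
  refine ⟨SimpleGraph.fromEdgeSet t, ?_, ?_⟩
  · rw [← SimpleGraph.edgeSet_subset_edgeSet, SimpleGraph.edgeSet_fromEdgeSet]
    exact Set.sdiff_subset.trans ht
  · rw [SimpleGraph.edgeSet_fromEdgeSet, sdiff_eq_left.2, htk]
    rw [Set.disjoint_left]
    intro e he hd
    exact G.not_isDiag_of_mem_edgeSet (ht he) hd

lemma exists_mpnn_separationProb_le {n k d : ℕ} {ε : ℝ} (hε : 0 < ε) {G H : SimpleGraph (Fin n)}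
    (hG : NeighborDegreesSeparate G) (σ : G ≃g H) (hk : k ≤ G.edgeSet.ncard)
    (f : SimpleGraph (Fin n) → EuclideanSpace ℝ (Fin d)) (hf : PermInvariant f) :
    ∃ U : UpstreamMPNN 1,
      separationProb f G H (exactlyK G (U.priors G) k) (exactlyK H (U.priors H) k) ≤ ε ∧
      separationProb f G H (exactlyK ⊤ (U.priors G) k) (exactlyK ⊤ (U.priors H) k) ≤ ε := by
  classical
  obtain ⟨S, hSG, hS⟩ := exists_le_edgeSet_ncard_eq hk
  obtain ⟨g, hg⟩ := exists_injective_multiset (EuclideanSpace ℝ (Fin 1))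
  set T : SimpleGraph (Fin n) := S.comap σ.symm with hTdef
  have hTH : T ≤ H := by
    intro a b hab
    exact σ.symm.map_adj_iff.1 (hSG hab)
  let τ : T ≃g S := ⟨σ.symm.toEquiv, Iff.rfl⟩
  have hT : T.edgeSet.ncard = k := by
    rw [← hS]
    exact Nat.card_congr τ.mapEdgeSet
  have hfST : f (G \ S) = f (H \ T) := by
    rw [← hf σ.toEquiv (H \ T)]
    congr 1
    ext a b
    simp only [SimpleGraph.sdiff_adj, SimpleGraph.comap_adj, hTdef]
    have h1 : H.Adj (σ.toEquiv a) (σ.toEquiv b) ↔ G.Adj a b := σ.map_adj_iff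
    have h2 : ∀ x, σ.symm (σ.toEquiv x) = x := fun x => σ.symm_apply_apply x
    rw [h1, h2, h2]
  have e1 := (tendsto_separationProb_sharpPriors f hSG hS hTH hT hfST).eventually_le_const hε
  have e2 := (tendsto_separationProb_sharpPriors f (le_top : S ≤ ⊤) hS (le_top : T ≤ ⊤) hT
    hfST).eventually_le_const hε
  -- One `M` serves both conventions for the candidate edges.
  obtain ⟨M, hM1, hM2⟩ := (e1.and e2).exists
  set φ := (twoLayerMPNN g fun _ => 0).feature G 2 with hφ
  have hφinj : Function.Injective φ := feature_injective hG hg _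
  -- The readout recognizes an edge of `S` by the unordered pair of its end features, which is
  -- unambiguous because `φ` is injective.
  set r : Sym2 (EuclideanSpace ℝ (Fin 1)) → ℝ :=
    fun s => if s ∈ Sym2.map φ '' S.edgeSet then M else -M with hr
  have hfeat : ∀ K : SimpleGraph (Fin n), ∀ t, (twoLayerMPNN g r).feature K t =
      (twoLayerMPNN g fun _ => 0).feature K t := by
    intro K t
    induction t with
    | zero => rfl
    | succ t ih => funext v; simp only [UpstreamMPNN.feature, ih]; rfl
  have hGp : (twoLayerMPNN g r).priors G = sharpPriors S M := by
    funext i j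
    have h0 : (twoLayerMPNN g r).priors G i j = r s(φ i, φ j) := by
      simp only [UpstreamMPNN.priors, hfeat]; rfl
    have h1 : s(φ i, φ j) ∈ Sym2.map φ '' S.edgeSet ↔ S.Adj i j := by
      rw [← Sym2.map_mk, (Sym2.map.injective hφinj).mem_set_image, SimpleGraph.mem_edgeSet]
    rw [h0]
    simp only [hr, h1, sharpPriors]
  have hHp : (twoLayerMPNN g r).priors H = sharpPriors T M := by
    funext i j
    have h0 : ∀ a b, (twoLayerMPNN g r).priors H (σ a) (σ b) =
        (twoLayerMPNN g r).priors G a b := by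
      intro a b
      simp only [UpstreamMPNN.priors, feature_iso]
    obtain ⟨a, rfl⟩ := σ.surjective i
    obtain ⟨b, rfl⟩ := σ.surjective j
    have h2 : ∀ x, σ.symm (σ x) = x := fun x => σ.symm_apply_apply x
    rw [h0, hGp]
    simp only [sharpPriors, hTdef, SimpleGraph.comap_adj, h2]
  refine ⟨twoLayerMPNN g r, ?_, ?_⟩
  · rw [hGp, hHp]; exact hM1
  · rw [hGp, hHp]; exact hM2

open Classical in
-- Isolated vertices all have the empty multiset, so there is at most one; the others contribute at
-- least 1 each to the degree sum.
lemma card_le_of_neighborDegreesSeparate {n : ℕ} {G : SimpleGraph (Fin n)}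
    (hG : NeighborDegreesSeparate G) : n ≤ 2 * G.edgeSet.ncard + 1 := by
  have h0 : #{v | G.degree v = 0} ≤ 1 := by
    rw [card_le_one]
    intro u hu v hv
    apply hG
    have h : ∀ w, G.degree w = 0 → G.neighborFinset w = ∅ := by
      intro w hw; rwa [← card_eq_zero, SimpleGraph.card_neighborFinset_eq_degree]
    have hu' := h u (by simpa using hu)
    have hv' := h v (by simpa using hv)
    simp only [hu', hv']
  have h1 : #{v | ¬ G.degree v = 0} ≤ ∑ v, G.degree v := by
    rw [card_filter]
    refine sum_le_sum fun v _ => ?_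
    split_ifs <;> omega
  have h2 := card_filter_add_card_filter_not (s := (univ : Finset (Fin n)))
    (fun v => G.degree v = 0)
  rw [SimpleGraph.sum_degrees_eq_twice_card_edges] at h1
  have h3 : #G.edgeFinset = G.edgeSet.ncard := by
    rw [← SimpleGraph.coe_edgeFinset, Set.ncard_coe_finset]
  simp only [card_univ, Fintype.card_fin] at h2
  omega

/-! ### Probability estimates for random graphs -/

section RandomGraph

variable {n : ℕ}

lemma symmDiff_adj (G K : SimpleGraph (Fin n)) (a b : Fin n) :
    (G ∆ K).Adj a b ↔ ¬ (G.Adj a b ↔ K.Adj a b) := by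
  simp only [symmDiff_def, SimpleGraph.sup_adj, SimpleGraph.sdiff_adj]
  tauto

lemma symmDiff_bijective {α : Type*} [GeneralizedBooleanAlgebra α] (K : α) :
    Function.Bijective fun G : α => G ∆ K :=
  Function.Involutive.bijective fun G => symmDiff_symmDiff_cancel_right K G

lemma card_filter_card_sdiff_le (W : Finset (Fin n)) (hW : #W < n) (j : ℕ) :
    (#{y : Finset (Fin n) | #(y \ W) = j} : ℝ) ≤ 2 ^ n * (1 / √(n - #W : ℕ)) := by
  have h : #{y : Finset (Fin n) | #(y \ W) = j} ≤ #(W.powerset ×ˢ powersetCard j Wᶜ) := by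
    refine card_le_card_of_injOn (fun y => (y ∩ W, y \ W)) ?_ ?_
    · intro y hy
      have hy' : #(y \ W) = j := by simpa using hy
      simp only [coe_product, Set.mem_prod, mem_coe, mem_powerset, mem_powersetCard]
      refine ⟨inter_subset_right, ?_, hy'⟩
      intro a ha
      simpa using (mem_sdiff.1 ha).2
    · intro y _ z _ hyz
      simp only [Prod.mk.injEq] at hyz
      rw [← sdiff_union_inter y W, ← sdiff_union_inter z W, hyz.1, hyz.2]
  rw [card_product, card_powerset, card_powersetCard, card_compl, Fintype.card_fin] at h
  calc (#{y : Finset (Fin n) | #(y \ W) = j} : ℝ)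
      ≤ 2 ^ #W * ((n - #W).choose j : ℕ) := by exact_mod_cast h
    _ ≤ 2 ^ #W * (2 ^ (n - #W) / √(n - #W : ℕ)) := by
        gcongr
        exact choose_le_two_pow_div_sqrt _ _ (by omega)
    _ = 2 ^ n * (1 / √(n - #W : ℕ)) := by
        have : (2 : ℝ) ^ n = 2 ^ #W * 2 ^ (n - #W) := by
          rw [← pow_add]; congr 1; omega
        rw [this]; ring

lemma card_filter_symmDiff (P : Finset (Fin n) → Prop) [DecidablePred P] (N : Finset (Fin n)) :
    #{s | P (N ∆ s)} = #{s | P s} := by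
  refine card_bij (fun s _ => N ∆ s) ?_ ?_ ?_
  · intro s hs; simpa using hs
  · intro s _ t _ h; exact symmDiff_right_injective N h
  · intro s hs
    exact ⟨N ∆ s, by simpa [symmDiff_symmDiff_cancel_left] using hs,
      symmDiff_symmDiff_cancel_left N s⟩

open Classical in
/-- All vertices of a given set `W` have degree `d` with small probability. -/
lemma ncard_degree_eq_le (W : Finset (Fin n)) (hW : #W < n) (d : ℕ) :
    ({G : SimpleGraph (Fin n) | ∀ a ∈ W, G.degree a = d}.ncard : ℝ) ≤
      (1 / √(n - #W : ℕ)) ^ #W * Nat.card (SimpleGraph (Fin n)) := by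
  -- Only pairs between `W` and its complement are toggled, so the degree of `a ∈ W` depends on `x
  -- a` alone and the bound factors over `W`.
  set K : (Fin n → Finset (Fin n)) → SimpleGraph (Fin n) :=
    fun x => SimpleGraph.fromRel fun a b => a ∈ W ∧ b ∉ W ∧ b ∈ x a with hK
  refine ncard_le_of_bijective_family _ (fun x G => G ∆ K x)
    (fun x => symmDiff_bijective _) _ fun G => ?_
  have hsub : {x | ∀ a ∈ W, (G ∆ K x).degree a = d} ⊆
      ↑(Fintype.piFinset fun a => if a ∈ W then
        ({s | #((G.neighborFinset a ∆ s) \ W) = d - #(G.neighborFinset a ∩ W)} :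
          Finset (Finset (Fin n))) else univ) := by
    intro x hx
    rw [mem_coe, Fintype.mem_piFinset]
    intro a
    by_cases ha : a ∈ W
    · have hx' : (G ∆ K x).degree a = d := hx a ha
      rw [if_pos ha, mem_filter]
      refine ⟨mem_univ _, ?_⟩
      have h1 : (G ∆ K x).neighborFinset a \ W = (G.neighborFinset a ∆ x a) \ W := by
        ext b
        by_cases hb : b ∈ W
        · simp [hb]
        · have hab : a ≠ b := fun h => hb (h ▸ ha)
          rw [Finset.mem_sdiff, Finset.mem_sdiff, mem_symmDiff, SimpleGraph.mem_neighborFinset,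
            SimpleGraph.mem_neighborFinset, symmDiff_adj]
          simp only [hK, SimpleGraph.fromRel_adj, ha, hb]
          tauto
      have h2 : (G ∆ K x).neighborFinset a ∩ W = G.neighborFinset a ∩ W := by
        ext b
        by_cases hb : b ∈ W
        · simp only [mem_inter, SimpleGraph.mem_neighborFinset, symmDiff_adj, hK,
            SimpleGraph.fromRel_adj, ha, hb]
          tauto
        · simp [hb]
      have h3 := card_sdiff_add_card_inter ((G ∆ K x).neighborFinset a) W
      rw [SimpleGraph.card_neighborFinset_eq_degree, hx', h1, h2] at h3
      omega
    · simp [ha]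
  calc ({x | ∀ a ∈ W, (G ∆ K x).degree a = d}.ncard : ℝ)
      ≤ (∏ a, #(if a ∈ W then
        ({s | #((G.neighborFinset a ∆ s) \ W) = d - #(G.neighborFinset a ∩ W)} :
          Finset (Finset (Fin n))) else univ) : ℕ) := by
        rw [← Fintype.card_piFinset]
        exact_mod_cast ncard_le_card_of_subset hsub
    _ = ∏ a, (#(if a ∈ W then
        ({s | #((G.neighborFinset a ∆ s) \ W) = d - #(G.neighborFinset a ∩ W)} :
          Finset (Finset (Fin n))) else univ) : ℝ) := by push_cast; rfl
    _ ≤ ∏ a : Fin n, (2 ^ n * if a ∈ W then 1 / √(n - #W : ℕ) else 1) := by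
        refine prod_le_prod (fun _ _ => by positivity) fun a _ => ?_
        split_ifs with ha
        · rw [card_filter_symmDiff (fun s => #(s \ W) = d - #(G.neighborFinset a ∩ W))]
          exact card_filter_card_sdiff_le W hW _
        · simp
    _ = (1 / √(n - #W : ℕ)) ^ #W * Nat.card (Fin n → Finset (Fin n)) := by
        rw [prod_mul_distrib, prod_ite_mem, univ_inter, prod_const, prod_const]
        simp [mul_comm, Nat.card_eq_fintype_card]

open Classical in
/-- The vertices other than `u` and `v` adjacent to exactly one of `u` and `v`. -/
def exclusiveNeighbors (G : SimpleGraph (Fin n)) (u v : Fin n) : Finset (Fin n) :=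
  {w | w ≠ u ∧ w ≠ v ∧ ¬ (G.Adj u w ↔ G.Adj v w)}

lemma mem_exclusiveNeighbors {G : SimpleGraph (Fin n)} {u v w : Fin n} :
    w ∈ exclusiveNeighbors G u v ↔ w ≠ u ∧ w ≠ v ∧ ¬ (G.Adj u w ↔ G.Adj v w) := by
  simp [exclusiveNeighbors]

open Classical in
lemma ncard_card_exclusiveNeighbors_lt_le {u v : Fin n} (huv : u ≠ v) (r : ℕ) :
    ({G : SimpleGraph (Fin n) | #(exclusiveNeighbors G u v) < r}.ncard : ℝ) ≤
      ((r + 2 : ℕ) * (n : ℝ) ^ (r + 2) / 2 ^ n) * Nat.card (SimpleGraph (Fin n)) := by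
  have : Nonempty (Fin n) := ⟨u⟩
  -- Toggling the adjacencies of `u` translates the set of exclusive neighbors by `x`, except at `u`
  -- and `v`; hence `r + 2` below.
  set K : Finset (Fin n) → SimpleGraph (Fin n) :=
    fun x => SimpleGraph.fromRel fun a b => a = u ∧ b ≠ v ∧ b ∈ x with hK
  refine ncard_le_of_bijective_family _ (fun x G => G ∆ K x)
    (fun x => symmDiff_bijective _) _ fun G => ?_
  have hsub : {x | #(exclusiveNeighbors (G ∆ K x) u v) < r} ⊆
      ↑({x | #(exclusiveNeighbors G u v ∆ x) < r + 2} : Finset (Finset (Fin n))) := by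
    intro x hx
    have hx' : #(exclusiveNeighbors (G ∆ K x) u v) < r := hx
    rw [mem_coe, mem_filter]
    refine ⟨mem_univ _, ?_⟩
    have h : exclusiveNeighbors G u v ∆ x ⊆ exclusiveNeighbors (G ∆ K x) u v ∪ {u, v} := by
      intro w hw
      by_cases hwu : w = u
      · simp [hwu]
      by_cases hwv : w = v
      · simp [hwv]
      simp only [mem_symmDiff, mem_exclusiveNeighbors, mem_union,
        mem_insert, mem_singleton, symmDiff_adj, hK, SimpleGraph.fromRel_adj] at hw ⊢
      simp only [hwu, hwv, huv.symm, Ne.symm hwu, Ne.symm hwv, ne_eq, not_false_eq_true, true_and,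
        false_and, or_false, and_false] at hw ⊢
      tauto
    have h1 := card_le_card h
    have h2 := card_union_le (exclusiveNeighbors (G ∆ K x) u v) {u, v}
    have h3 := card_le_two (a := u) (b := v)
    omega
  have h1 := ncard_le_card_of_subset hsub
  rw [card_filter_symmDiff (fun s => #s < r + 2)] at h1
  have h2 := h1.trans (card_filter_card_lt_le (V := Fin n) (r + 2))
  rw [Fintype.card_fin] at h2
  have h3 : ((r + 2 : ℕ) * (n : ℝ) ^ (r + 2) / 2 ^ n) * Nat.card (Finset (Fin n)) =
      (r + 2 : ℕ) * (n : ℝ) ^ (r + 2) := by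
    simp [Nat.card_eq_fintype_card]
  rw [h3]
  exact_mod_cast h2

open Classical in
/-- A set that splits each of several disjoint nonempty parts in half is determined by its trace
outside of a transversal. -/
lemma card_filter_halving_le (D : Finset (Fin n)) (c : Fin n → ℕ) :
    #{y : Finset (Fin n) | ∀ k, 2 * #{w ∈ D | c w = k ∧ w ∈ y} = #{w ∈ D | c w = k}} ≤
      2 ^ (n - #(D.image c)) := by
  rcases isEmpty_or_nonempty (Fin n) with h0 | ⟨⟨w₀⟩⟩
  · have hD : D = ∅ := Finset.eq_empty_of_isEmpty D
    subst hD
    simpa using Nat.one_le_two_pow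
  have hrep : ∀ k ∈ D.image c, ∃ w ∈ D, c w = k := by
    intro k hk; simpa using hk
  obtain ⟨ρ, hρ⟩ : ∃ ρ : ℕ → Fin n, ∀ k ∈ D.image c, ρ k ∈ D ∧ c (ρ k) = k := by
    have hk : ∀ k : ℕ, ∃ w : Fin n, k ∈ D.image c → w ∈ D ∧ c w = k := by
      intro k
      by_cases hk : k ∈ D.image c
      · obtain ⟨w, hw⟩ := hrep k hk; exact ⟨w, fun _ => hw⟩
      · exact ⟨w₀, fun h => absurd h hk⟩
    choose ρ hρ using hk
    exact ⟨ρ, hρ⟩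
  have hρD := fun k hk => (hρ k hk).1
  have hρc := fun k hk => (hρ k hk).2
  set R := (D.image c).image ρ with hR
  have hRcard : #R = #(D.image c) := by
    refine card_image_of_injOn fun a ha b hb hab => ?_
    rw [← hρc a ha, ← hρc b hb, hab]
  have hcard : #(Rᶜ).powerset = 2 ^ (n - #(D.image c)) := by
    rw [card_powerset, card_compl, hRcard, Fintype.card_fin]
  rw [← hcard]
  refine card_le_card_of_injOn (fun y => y \ R) ?_ ?_
  · intro y _
    simp only [mem_coe, mem_powerset]
    intro a ha
    simpa using (mem_sdiff.1 ha).2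
  · intro y hy z hz hyz
    have hy' := (mem_filter.1 hy).2
    have hz' := (mem_filter.1 hz).2
    have hout : ∀ w, w ∉ R → (w ∈ y ↔ w ∈ z) := by
      intro w hw
      have := Finset.ext_iff.1 hyz w
      simpa [hw] using this
    ext w
    by_cases hw : w ∈ R
    · obtain ⟨k, hk, rfl⟩ := mem_image.1 hw
      -- The class of `k` meets `R` only in `ρ k`; the halving condition then decides whether `ρ k`
      -- belongs to the set.
      have huniq : ∀ a ∈ D, c a = k → a ≠ ρ k → a ∉ R := by
        intro a _ hak hne haR
        obtain ⟨l, hl, rfl⟩ := mem_image.1 haR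
        rw [hρc l hl] at hak
        exact hne (by rw [hak])
      have hsplit : ∀ s : Finset (Fin n), #{w ∈ D | c w = k ∧ w ∈ s} =
          #{w ∈ D | c w = k ∧ w ≠ ρ k ∧ w ∈ s} + if ρ k ∈ s then 1 else 0 := by
        intro s
        split_ifs with hs
        · rw [← card_insert_of_notMem (a := ρ k) (by simp)]
          congr 1
          ext a
          simp only [mem_filter, mem_insert]
          by_cases ha : a = ρ k
          · subst ha; simp [hρD k hk, hρc k hk, hs]
          · simp [ha]
        · rw [add_zero]
          congr 1
          ext a
          simp only [mem_filter]
          by_cases ha : a = ρ k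
          · subst ha; simp [hs]
          · simp [ha]
      have heq : #{w ∈ D | c w = k ∧ w ≠ ρ k ∧ w ∈ y} = #{w ∈ D | c w = k ∧ w ≠ ρ k ∧ w ∈ z} := by
        congr 1
        ext a
        simp only [mem_filter]
        constructor
        · rintro ⟨h1, h2, h3, h4⟩
          exact ⟨h1, h2, h3, (hout a (huniq a h1 h2 h3)).1 h4⟩
        · rintro ⟨h1, h2, h3, h4⟩
          exact ⟨h1, h2, h3, (hout a (huniq a h1 h2 h3)).2 h4⟩
      have h1 := hy' k
      have h2 := hz' k
      rw [hsplit, heq] at h1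
      rw [hsplit] at h2
      by_cases h3 : ρ k ∈ y <;> by_cases h4 : ρ k ∈ z <;>
        simp only [h3, h4, if_true, if_false] at h1 h2 ⊢ <;> omega
    · exact hout w hw

/-- The complete bipartite graph between `{u, v}` and `y \ {u, v}`. -/
def crossGraph (u v : Fin n) (y : Finset (Fin n)) : SimpleGraph (Fin n) :=
  SimpleGraph.fromRel fun a b => (a = u ∨ a = v) ∧ b ≠ u ∧ b ≠ v ∧ b ∈ y

/-- Exchange the adjacencies to `u` and to `v` of all vertices in `x`. -/
def exchange (u v : Fin n) (x : Finset (Fin n)) (G : SimpleGraph (Fin n)) :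
    SimpleGraph (Fin n) :=
  G ∆ crossGraph u v (exclusiveNeighbors G u v ∩ x)

/-- At each vertex, the adjacencies to `u` and `v` are toggled together or not at all. This is what
makes `exchange` an involution. -/
lemma exclusiveNeighbors_symmDiff_crossGraph (G : SimpleGraph (Fin n)) {u v : Fin n}
    (y : Finset (Fin n)) :
    exclusiveNeighbors (G ∆ crossGraph u v y) u v = exclusiveNeighbors G u v := by
  ext w
  by_cases hwu : w = u
  · simp [hwu, mem_exclusiveNeighbors]
  by_cases hwv : w = v
  · simp [hwv, mem_exclusiveNeighbors]
  simp only [mem_exclusiveNeighbors, symmDiff_adj, crossGraph,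
    SimpleGraph.fromRel_adj, hwu, hwv, Ne.symm hwu, Ne.symm hwv, ne_eq, not_false_eq_true]
  tauto

lemma exclusiveNeighbors_exchange (G : SimpleGraph (Fin n)) {u v : Fin n}
    (x : Finset (Fin n)) :
    exclusiveNeighbors (exchange u v x G) u v = exclusiveNeighbors G u v :=
  exclusiveNeighbors_symmDiff_crossGraph _ _

lemma exchange_bijective {u v : Fin n} (x : Finset (Fin n)) :
    Function.Bijective (exchange u v x) := by
  refine Function.Involutive.bijective fun G => ?_
  rw [exchange, exclusiveNeighbors_exchange, exchange, symmDiff_symmDiff_cancel_right]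

lemma exchange_adj_left {G : SimpleGraph (Fin n)} {u v : Fin n} {x : Finset (Fin n)} {w : Fin n}
    (hw : w ∈ exclusiveNeighbors G u v) :
    (exchange u v x G).Adj u w ↔ ¬ (G.Adj u w ↔ w ∈ x) := by
  have hw' := hw
  rw [mem_exclusiveNeighbors] at hw'
  obtain ⟨h1, h2, h3⟩ := hw'
  simp only [exchange, symmDiff_adj, crossGraph, SimpleGraph.fromRel_adj, mem_inter, hw, h1, h2,
    Ne.symm h1, ne_eq, not_false_eq_true]
  tauto

open Classical in
-- An exclusive neighbor is adjacent to just one of `u` and `v`; toggling both adjacencies replaces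
-- that one by the other.
lemma degree_exchange {G : SimpleGraph (Fin n)} {u v : Fin n} (huv : u ≠ v) {x : Finset (Fin n)}
    {w : Fin n} (hw : w ∈ exclusiveNeighbors G u v) :
    (exchange u v x G).degree w = G.degree w := by
  by_cases hwx : w ∈ x
  · have hw' := hw
    rw [mem_exclusiveNeighbors] at hw'
    obtain ⟨h1, h2, h3⟩ := hw'
    have h : (exchange u v x G).neighborFinset w =
        (G.neighborFinset w).map (Equiv.swap u v).toEmbedding := by
      ext b
      have hb : b ∈ (G.neighborFinset w).map (Equiv.swap u v).toEmbedding ↔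
          G.Adj w (Equiv.swap u v b) := by
        rw [mem_map_equiv, Equiv.symm_swap, SimpleGraph.mem_neighborFinset]
      rw [hb, SimpleGraph.mem_neighborFinset, exchange, symmDiff_adj]
      rw [G.adj_comm u w, G.adj_comm v w] at h3
      by_cases hbu : b = u
      · subst hbu
        simp only [crossGraph, SimpleGraph.fromRel_adj, mem_inter, hw, hwx, h1, h2,
          Equiv.swap_apply_left]
        tauto
      by_cases hbv : b = v
      · subst hbv
        simp only [crossGraph, SimpleGraph.fromRel_adj, mem_inter, hw, hwx, h1, h2,
          Equiv.swap_apply_right]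
        tauto
      rw [Equiv.swap_apply_of_ne_of_ne hbu hbv]
      simp only [crossGraph, SimpleGraph.fromRel_adj, h1, h2, hbu, hbv]
      tauto
    rw [← SimpleGraph.card_neighborFinset_eq_degree, h, card_map,
      SimpleGraph.card_neighborFinset_eq_degree]
  · have h : (exchange u v x G).neighborFinset w = G.neighborFinset w := by
      have hw' := hw
      rw [mem_exclusiveNeighbors] at hw'
      obtain ⟨h1, h2, h3⟩ := hw'
      ext b
      rw [SimpleGraph.mem_neighborFinset, SimpleGraph.mem_neighborFinset, exchange, symmDiff_adj]
      simp only [crossGraph, SimpleGraph.fromRel_adj, h1, h2, hwx, mem_inter]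
      tauto
    rw [← SimpleGraph.card_neighborFinset_eq_degree, h,
      SimpleGraph.card_neighborFinset_eq_degree]

open Classical in
/-- If `u` and `v` have the same multiset of neighbor degrees, then each degree class of the
exclusive neighbors is split in half. -/
lemma two_mul_card_filter_adj_eq {G : SimpleGraph (Fin n)} {u v : Fin n}
    (h : (G.neighborFinset u).val.map (fun w => G.degree w) =
      (G.neighborFinset v).val.map (fun w => G.degree w)) (k : ℕ) :
    2 * #{w ∈ exclusiveNeighbors G u v | G.degree w = k ∧ G.Adj u w} =
      #{w ∈ exclusiveNeighbors G u v | G.degree w = k} := by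
  have hdeg : G.degree u = G.degree v := by
    have := congrArg Multiset.card h
    simpa using this
  have hcount : #{w | G.Adj u w ∧ G.degree w = k} = #{w | G.Adj v w ∧ G.degree w = k} := by
    have hc : ∀ a, Multiset.count k ((G.neighborFinset a).val.map (fun w => G.degree w)) =
        #{w | G.Adj a w ∧ G.degree w = k} := by
      intro a
      rw [Multiset.count_map, ← filter_val, card_val]
      congr 1
      ext w
      simp [eq_comm]
    rw [← hc, ← hc, h]
  have hsplit : ∀ a : Fin n, #{w | G.Adj a w ∧ G.degree w = k} =
      #{w ∈ exclusiveNeighbors G u v | G.degree w = k ∧ G.Adj a w} +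
      #{w | w ∉ exclusiveNeighbors G u v ∧ G.Adj a w ∧ G.degree w = k} := by
    intro a
    rw [← card_filter_add_card_filter_not (s := ({w | G.Adj a w ∧ G.degree w = k} : Finset (Fin n)))
      (fun w => w ∈ exclusiveNeighbors G u v), filter_filter, filter_filter]
    congr 2
    · ext w; simp only [mem_filter, mem_univ, true_and]; tauto
    · ext w; simp only [mem_filter, mem_univ, true_and]; tauto
  -- A non-exclusive vertex other than `u`, `v` counts for both or neither. If `u` and `v` are
  -- adjacent, they count for each other, with equal degrees; the transposition matches these cases.
  have hrest : #{w | w ∉ exclusiveNeighbors G u v ∧ G.Adj u w ∧ G.degree w = k} =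
      #{w | w ∉ exclusiveNeighbors G u v ∧ G.Adj v w ∧ G.degree w = k} := by
    refine card_equiv (Equiv.swap u v) fun w => ?_
    simp only [mem_filter, mem_univ, true_and, mem_exclusiveNeighbors]
    by_cases hwu : w = u
    · subst hwu; simp
    by_cases hwv : w = v
    · subst hwv
      rw [Equiv.swap_apply_right]
      simp [hdeg, G.adj_comm w u]
    rw [Equiv.swap_apply_of_ne_of_ne hwu hwv]
    tauto
  have hhalf : #{w ∈ exclusiveNeighbors G u v | G.degree w = k} =
      #{w ∈ exclusiveNeighbors G u v | G.degree w = k ∧ G.Adj u w} +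
      #{w ∈ exclusiveNeighbors G u v | G.degree w = k ∧ G.Adj v w} := by
    rw [← card_filter_add_card_filter_not (s := {w ∈ exclusiveNeighbors G u v | G.degree w = k})
      (fun w => G.Adj u w), filter_filter, filter_filter]
    congr 2
    ext w
    simp only [mem_filter, mem_exclusiveNeighbors]
    tauto
  have h1 := hsplit u
  have h2 := hsplit v
  omega

open Classical in
-- Exchanges fix the degree classes `D` is divided into, while the adjacencies of `u` to `D` become
-- a translate of `x`. So `x` must, up to translation, halve every class, which
-- `card_filter_halving_le` counts.
lemma ncard_map_degree_eq_le {u v : Fin n} (huv : u ≠ v) (L : ℕ) :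
    ({G : SimpleGraph (Fin n) |
      (G.neighborFinset u).val.map (fun w => G.degree w) =
        (G.neighborFinset v).val.map (fun w => G.degree w) ∧
      L ≤ #((exclusiveNeighbors G u v).image fun w => G.degree w)}.ncard : ℝ) ≤
      (1 / 2 ^ L) * Nat.card (SimpleGraph (Fin n)) := by
  refine ncard_le_of_bijective_family _ (exchange u v) exchange_bijective _ fun G => ?_
  set D := exclusiveNeighbors G u v with hD
  have hdeg : ∀ x, ∀ w ∈ D, (exchange u v x G).degree w = G.degree w :=
    fun x w hw => degree_exchange huv hw
  have himg : ∀ x, (D.image fun w => (exchange u v x G).degree w) =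
      D.image fun w => G.degree w := fun x => image_congr fun w hw => hdeg x w hw
  simp only [exclusiveNeighbors_exchange, ← hD, himg]
  by_cases hL : L ≤ #(D.image fun w => G.degree w)
  · have hsub : {x | (((exchange u v x G).neighborFinset u).val.map
        (fun w => (exchange u v x G).degree w) = ((exchange u v x G).neighborFinset v).val.map
        (fun w => (exchange u v x G).degree w)) ∧ L ≤ #(D.image fun w => G.degree w)} ⊆
        ↑({x | ∀ k, 2 * #{w ∈ D | G.degree w = k ∧ w ∈ G.neighborFinset u ∆ x} =
          #{w ∈ D | G.degree w = k}} : Finset (Finset (Fin n))) := by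
      intro x hx
      rw [mem_coe, mem_filter]
      refine ⟨mem_univ _, fun k => ?_⟩
      have := two_mul_card_filter_adj_eq hx.1 k
      rw [exclusiveNeighbors_exchange, ← hD] at this
      have e1 : {w ∈ D | G.degree w = k ∧ w ∈ G.neighborFinset u ∆ x} =
          {w ∈ D | (exchange u v x G).degree w = k ∧ (exchange u v x G).Adj u w} := by
        refine filter_congr fun w hw => ?_
        rw [hdeg x w hw, exchange_adj_left hw, mem_symmDiff, SimpleGraph.mem_neighborFinset]
        tauto
      have e2 : {w ∈ D | G.degree w = k} = {w ∈ D | (exchange u v x G).degree w = k} :=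
        filter_congr fun w hw => by rw [hdeg x w hw]
      rw [e1, e2]
      exact this
    have h1 := ncard_le_card_of_subset hsub
    rw [card_filter_symmDiff (fun s => ∀ k, 2 * #{w ∈ D | G.degree w = k ∧ w ∈ s} =
          #{w ∈ D | G.degree w = k})] at h1
    have h2 := h1.trans (card_filter_halving_le D fun w => G.degree w)
    have hn : #(D.image fun w => G.degree w) ≤ n :=
      card_image_le.trans (card_le_univ D |>.trans (by simp))
    have h3 := h2.trans (Nat.pow_le_pow_right two_pos (Nat.sub_le_sub_left hL n))
    have h4 : (1 / 2 ^ L : ℝ) * Nat.card (Finset (Fin n)) = 2 ^ (n - L) := by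
      rw [Nat.card_eq_fintype_card, Fintype.card_finset, Fintype.card_fin]
      push_cast
      rw [pow_sub₀ _ two_ne_zero (hL.trans hn)]
      field_simp
    rw [h4]
    exact_mod_cast h3
  · simp only [hL, and_false, Set.ofPred_false, Set.ncard_empty, Nat.cast_zero]
    positivity

end RandomGraph

/-! ### Union bound and choice of parameters -/

section AlmostAll

open Classical in
-- Pigeonhole: at least `L * w` exclusive neighbors in degree classes of size at most `w` show at
-- least `L` degrees.
lemma neighborDegreesSeparate_of_forall {n w L : ℕ} (hw : 0 < w) {G : SimpleGraph (Fin n)}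
    (h1 : ∀ W : Finset (Fin n), #W = w → ∀ d < n, ¬ ∀ a ∈ W, G.degree a = d)
    (h2 : ∀ u v, u ≠ v → L * w ≤ #(exclusiveNeighbors G u v))
    (h3 : ∀ u v, u ≠ v → ¬ ((G.neighborFinset u).val.map (fun w => G.degree w) =
        (G.neighborFinset v).val.map (fun w => G.degree w) ∧
      L ≤ #((exclusiveNeighbors G u v).image fun w => G.degree w))) :
    NeighborDegreesSeparate G := by
  intro u v huv
  by_contra hne
  refine h3 u v hne ⟨huv, ?_⟩
  have hcls : #(exclusiveNeighbors G u v) ≤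
      w * #((exclusiveNeighbors G u v).image fun w => G.degree w) := by
    refine card_le_mul_card_image _ _ fun d hd => ?_
    by_contra! hlt
    obtain ⟨W, hW, hWc⟩ := exists_subset_card_eq hlt.le
    obtain ⟨a, -, rfl⟩ := mem_image.1 hd
    refine h1 W hWc (G.degree a) ?_ fun b hb => (mem_filter.1 (hW hb)).2
    simpa using G.degree_lt_card_verts a
  have := (h2 u v hne).trans hcls
  rw [mul_comm] at this
  exact Nat.le_of_mul_le_mul_left this hw

open Classical in
lemma ncard_not_neighborDegreesSeparate_le {n w : ℕ} (hw : 0 < w) (hwn : w < n) (L : ℕ) :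
    ({G : SimpleGraph (Fin n) | ¬ NeighborDegreesSeparate G}.ncard : ℝ) ≤
      (n * (n.choose w * (1 / √(n - w : ℕ)) ^ w) +
        n ^ 2 * ((L * w + 2 : ℕ) * (n : ℝ) ^ (L * w + 2) / 2 ^ n) + n ^ 2 * (1 / 2 ^ L)) *
      Nat.card (SimpleGraph (Fin n)) := by
  set N : ℝ := (Nat.card (SimpleGraph (Fin n)) : ℝ) with hN
  set T₁ := powersetCard w (univ : Finset (Fin n)) ×ˢ range n with hT₁
  set T₂ := (univ : Finset (Fin n × Fin n)).filter fun p => p.1 ≠ p.2 with hT₂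
  set A : Finset (Fin n) × ℕ → Set (SimpleGraph (Fin n)) :=
    fun p => {G | ∀ a ∈ p.1, G.degree a = p.2} with hA
  set B : Fin n × Fin n → Set (SimpleGraph (Fin n)) :=
    fun p => {G | #(exclusiveNeighbors G p.1 p.2) < L * w} with hB
  set C : Fin n × Fin n → Set (SimpleGraph (Fin n)) :=
    fun p => {G | (G.neighborFinset p.1).val.map (fun w => G.degree w) =
        (G.neighborFinset p.2).val.map (fun w => G.degree w) ∧
      L ≤ #((exclusiveNeighbors G p.1 p.2).image fun w => G.degree w)} with hC
  have hsub : {G : SimpleGraph (Fin n) | ¬ NeighborDegreesSeparate G} ⊆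
      (⋃ p ∈ T₁, A p) ∪ (⋃ p ∈ T₂, B p) ∪ (⋃ p ∈ T₂, C p) := by
    intro G hG
    by_contra hcon
    simp only [Set.mem_union, Set.mem_iUnion, not_or, not_exists] at hcon
    obtain ⟨⟨hc1, hc2⟩, hc3⟩ := hcon
    refine hG (neighborDegreesSeparate_of_forall hw (L := L) ?_ ?_ ?_)
    · intro W hW d hd h
      exact hc1 (W, d) (by simp [hT₁, mem_powersetCard, hW, hd]) h
    · intro u v huv
      exact not_lt.1 (hc2 (u, v) (by simp [hT₂, huv]))
    · intro u v huv
      exact hc3 (u, v) (by simp [hT₂, huv])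
  have hT₁c : (#T₁ : ℝ) = n * n.choose w := by
    rw [hT₁, card_product, card_powersetCard, card_range, card_univ, Fintype.card_fin]
    push_cast; ring
  have hT₂c : (#T₂ : ℝ) ≤ n ^ 2 := by
    have := card_le_univ T₂
    rw [Fintype.card_prod, Fintype.card_fin, ← sq] at this
    exact_mod_cast this
  have key : ∀ {ι : Type} (T : Finset ι) (S : ι → Set (SimpleGraph (Fin n))) (b : ℝ),
      (∀ i ∈ T, ((S i).ncard : ℝ) ≤ b) → ((⋃ i ∈ T, S i).ncard : ℝ) ≤ #T * b := by
    intro ι T S b hb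
    calc ((⋃ i ∈ T, S i).ncard : ℝ) ≤ ((∑ i ∈ T, (S i).ncard : ℕ) : ℝ) := by
          exact_mod_cast set_ncard_biUnion_le T S
      _ = ∑ i ∈ T, ((S i).ncard : ℝ) := by push_cast; rfl
      _ ≤ ∑ i ∈ T, b := sum_le_sum hb
      _ = _ := by simp
  have k1 : ((⋃ p ∈ T₁, A p).ncard : ℝ) ≤ #T₁ * ((1 / √(n - w : ℕ)) ^ w * N) := by
    refine key _ _ _ fun p hp => ?_
    have hpw : #p.1 = w := (mem_powersetCard.1 (mem_product.1 hp).1).2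
    have := ncard_degree_eq_le p.1 (hpw ▸ hwn) p.2
    rwa [hpw] at this
  have k2 : ((⋃ p ∈ T₂, B p).ncard : ℝ) ≤
      #T₂ * (((L * w + 2 : ℕ) * (n : ℝ) ^ (L * w + 2) / 2 ^ n) * N) :=
    key _ _ _ fun p hp => ncard_card_exclusiveNeighbors_lt_le (mem_filter.1 hp).2 _
  have k3 : ((⋃ p ∈ T₂, C p).ncard : ℝ) ≤ #T₂ * ((1 / 2 ^ L) * N) :=
    key _ _ _ fun p hp => ncard_map_degree_eq_le (mem_filter.1 hp).2 _
  have hN0 : 0 ≤ N := Nat.cast_nonneg _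
  have k2' := k2.trans (mul_le_mul_of_nonneg_right hT₂c (by positivity))
  have k3' := k3.trans (mul_le_mul_of_nonneg_right hT₂c (by positivity))
  rw [hT₁c] at k1
  have hu : ({G : SimpleGraph (Fin n) | ¬ NeighborDegreesSeparate G}.ncard : ℝ) ≤
      (⋃ p ∈ T₁, A p).ncard + (⋃ p ∈ T₂, B p).ncard + (⋃ p ∈ T₂, C p).ncard := by
    have h1 := Set.ncard_le_ncard hsub (Set.toFinite _)
    have h2 := Set.ncard_union_le ((⋃ p ∈ T₁, A p) ∪ (⋃ p ∈ T₂, B p)) (⋃ p ∈ T₂, C p)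
    have h3 := Set.ncard_union_le (⋃ p ∈ T₁, A p) (⋃ p ∈ T₂, B p)
    exact_mod_cast h1.trans (h2.trans (Nat.add_le_add_right h3 _))
  linarith

lemma choose_mul_pow_le {n w : ℕ} (hn : 0 < n) (hw : 16 * √n ≤ w) (hwn : 2 * w ≤ n) :
    (n.choose w : ℝ) * (1 / √(n - w : ℕ)) ^ w ≤ (1 / 2) ^ w := by
  have hn' : (0 : ℝ) < n := by exact_mod_cast hn
  have hsn : 0 < √(n : ℝ) := Real.sqrt_pos.2 hn'
  have hw0 : (0 : ℝ) < w := lt_of_lt_of_le (by positivity) hw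
  have hs : √(n : ℝ) / 2 ≤ √(n - w : ℕ) := by
    apply Real.le_sqrt_of_sq_le
    rw [div_pow, Real.sq_sqrt hn'.le, Nat.cast_sub (by omega)]
    have : (2 * w : ℝ) ≤ n := by exact_mod_cast hwn
    linarith
  have hs0 : 0 < √((n - w : ℕ) : ℝ) := lt_of_lt_of_le (by positivity) hs
  have hch : (n.choose w : ℝ) ≤ (Real.exp 1 * n / w) ^ w := by
    have h1 : (n.choose w : ℝ) ≤ (n : ℝ) ^ w / w.factorial := Nat.choose_le_pow_div w n
    have h2 := Real.pow_div_factorial_le_exp (w : ℝ) hw0.le w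
    have h3 : Real.exp w = Real.exp 1 ^ w := by rw [← Real.exp_nat_mul, mul_one]
    rw [h3] at h2
    calc (n.choose w : ℝ) ≤ (n : ℝ) ^ w / w.factorial := h1
      _ = ((w : ℝ) ^ w / w.factorial) * (n / w) ^ w := by
        rw [div_pow]; field_simp
      _ ≤ Real.exp 1 ^ w * (n / w) ^ w := by gcongr
      _ = _ := by rw [← mul_pow, mul_div_assoc]
  calc (n.choose w : ℝ) * (1 / √(n - w : ℕ)) ^ w
      ≤ (Real.exp 1 * n / w) ^ w * (1 / √(n - w : ℕ)) ^ w := by gcongr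
    _ = (Real.exp 1 * n / (w * √(n - w : ℕ))) ^ w := by
        rw [← mul_pow]; congr 1; field_simp
    -- Since `w ≥ 16√n` and `√(n - w) ≥ √n / 2`, the base is at most `e / 8`.
    _ ≤ (1 / 2) ^ w := by
        refine pow_le_pow_left₀ (by positivity) ?_ w
        rw [div_le_div_iff₀ (by positivity) two_pos]
        have he : Real.exp 1 < 3 := Real.exp_one_lt_d9.trans (by norm_num)
        have h1 : (16 * √n) * (√(n : ℝ) / 2) ≤ w * √(n - w : ℕ) := by gcongr
        have h2 : √(n : ℝ) * √n = n := Real.mul_self_sqrt hn'.le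
        nlinarith

/-- With `l = log₂ n + 1`, `w = 16(⌊√n⌋ + 1)` and `L = 3l`, this reads `l(Lw + 6) ≤ n`, which makes
`n ^ (Lw + 6) ≤ 2 ^ n`. -/
lemma eventually_log_mul_sqrt_le : ∀ᶠ n : ℕ in atTop,
    (Nat.log 2 n + 1) * (48 * (Nat.log 2 n + 1) * (n.sqrt + 1) + 6) ≤ n := by
  have h1 : ∀ᶠ n : ℕ in atTop, Real.log n ≤ (n : ℝ) ^ (1 / 8 : ℝ) := by
    have := (isLittleO_log_rpow_atTop (show (0 : ℝ) < 1 / 8 by norm_num)).bound one_pos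
    filter_upwards [tendsto_natCast_atTop_atTop.eventually this] with n hn
    rw [one_mul, Real.norm_eq_abs, Real.norm_eq_abs,
      abs_of_nonneg (Real.rpow_nonneg (Nat.cast_nonneg n) _)] at hn
    exact (le_abs_self _).trans hn
  have h2 : ∀ᶠ n : ℕ in atTop, (30 : ℝ) ≤ (n : ℝ) ^ (1 / 8 : ℝ) :=
    ((tendsto_rpow_atTop (show (0 : ℝ) < 1 / 8 by norm_num)).comp
      tendsto_natCast_atTop_atTop).eventually_ge_atTop 30
  filter_upwards [h1, h2, eventually_gt_atTop 1] with n hn1 hn2 hn3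
  -- In terms of `t` the left side is at most `882 t⁶`, and `t ≥ 30` gives `882 ≤ t²`.
  set t : ℝ := (n : ℝ) ^ (1 / 8 : ℝ) with ht
  have hn0 : (0 : ℝ) ≤ n := Nat.cast_nonneg n
  have ht8 : t ^ 8 = n := by
    rw [ht, ← Real.rpow_natCast, ← Real.rpow_mul hn0]; norm_num
  have ht4 : √(n : ℝ) = t ^ 4 := by
    rw [← ht8, show t ^ 8 = (t ^ 4) ^ 2 by ring, Real.sqrt_sq (by positivity)]
  have hl : ((Nat.log 2 n + 1 : ℕ) : ℝ) ≤ 3 * t := by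
    have ha : (Nat.log 2 n : ℝ) ≤ Real.logb 2 n := by exact_mod_cast Real.natLog_le_logb n 2
    have hlog2 := Real.log_two_gt_d9
    have hlogn : 0 ≤ Real.log n := Real.log_natCast_nonneg n
    have hb : Real.logb 2 n ≤ 2 * Real.log n := by
      rw [Real.logb, div_le_iff₀ (by linarith)]
      nlinarith
    push_cast
    linarith
  have hs : ((n.sqrt + 1 : ℕ) : ℝ) ≤ 2 * t ^ 4 := by
    have ha : (n.sqrt : ℝ) ≤ √n := Real.nat_sqrt_le_real_sqrt
    have hb : 1 ≤ t ^ 4 := one_le_pow₀ (by linarith)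
    push_cast
    linarith
  have hfin : ((Nat.log 2 n + 1 : ℕ) : ℝ) *
      (48 * (Nat.log 2 n + 1 : ℕ) * (n.sqrt + 1 : ℕ) + 6) ≤ n := by
    calc _ ≤ (3 * t) * (48 * (3 * t) * (2 * t ^ 4) + 6) := by gcongr
      _ = 864 * t ^ 6 + 18 * t := by ring
      _ ≤ 864 * t ^ 6 + 18 * t ^ 6 := by
        have : t ≤ t ^ 6 := le_self_pow₀ (by linarith) (by norm_num)
        linarith
      _ = t ^ 6 * 882 := by ring
      _ ≤ t ^ 6 * t ^ 2 := by gcongr; nlinarith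
      _ = n := by rw [← ht8]; ring
  exact_mod_cast hfin

lemma ncard_not_neighborDegreesSeparate_le_three_div {n : ℕ}
    (h : (Nat.log 2 n + 1) * (48 * (Nat.log 2 n + 1) * (n.sqrt + 1) + 6) ≤ n) :
    ({G : SimpleGraph (Fin n) | ¬ NeighborDegreesSeparate G}.ncard : ℝ) ≤
      3 / n * Nat.card (SimpleGraph (Fin n)) := by
  set l := Nat.log 2 n + 1 with hl
  set s := n.sqrt + 1 with hs
  have hl1 : 1 ≤ l := by omega
  have hs1 : 1 ≤ s := by omega
  have hnl : n ≤ 2 ^ l := (Nat.lt_pow_succ_log_self one_lt_two n).le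
  have hns : n < s ^ 2 := by rw [sq]; exact Nat.lt_succ_sqrt n
  clear_value l s
  have hls : l ≤ s := by
    have h1 : (48 * l * l) * s < s * s := by nlinarith
    have h2 := Nat.lt_of_mul_lt_mul_right h1
    nlinarith
  have h48 : 48 * s + 6 ≤ n := by
    calc 48 * s + 6 = 1 * (48 * 1 * s + 6) := by ring
      _ ≤ l * (48 * l * s + 6) := by gcongr
      _ ≤ n := h
  have hn0 : 0 < n := by omega
  have hn' : (0 : ℝ) < n := by exact_mod_cast hn0
  have hnl' : (n : ℝ) ≤ 2 ^ l := by exact_mod_cast hnl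
  -- Here `w` exceeds `16√n` as `choose_mul_pow_le` requires, and `2 ^ (3l) ≥ n³` beats the `n²`
  -- pairs. Each of the three terms is at most `1 / n`.
  refine (ncard_not_neighborDegreesSeparate_le (w := 16 * s) (by omega) (by omega)
    (3 * l)).trans ?_
  refine mul_le_mul_of_nonneg_right ?_ (Nat.cast_nonneg _)
  have hw : 16 * √(n : ℝ) ≤ (16 * s : ℕ) := by
    have : √(n : ℝ) ≤ s := by
      rw [Real.sqrt_le_left (Nat.cast_nonneg _)]
      exact_mod_cast hns.le
    push_cast
    linarith
  have t1 : (n : ℝ) * (n.choose (16 * s) * (1 / √(n - 16 * s : ℕ)) ^ (16 * s)) ≤ 1 / n := by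
    calc _ ≤ (n : ℝ) * (1 / 2) ^ (16 * s) := by
          gcongr; exact choose_mul_pow_le hn0 hw (by omega)
      _ ≤ n * (1 / 2) ^ (2 * l) := by
          gcongr ?_ * ?_
          exact pow_le_pow_of_le_one (by norm_num) (by norm_num) (by omega)
      _ = n * (1 / (2 ^ l * 2 ^ l)) := by rw [one_div_pow, two_mul, pow_add]
      _ ≤ n * (1 / (n * n)) := by gcongr
      _ = 1 / n := by field_simp
  have t2 : (n : ℝ) ^ 2 * ((3 * l * (16 * s) + 2 : ℕ) * (n : ℝ) ^ (3 * l * (16 * s) + 2) / 2 ^ n) ≤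
      1 / n := by
    set r := 3 * l * (16 * s) + 2 with hr
    have hlr : l * (r + 4) ≤ n := by
      calc l * (r + 4) = l * (48 * l * s + 6) := by rw [hr]; ring
        _ ≤ n := h
    clear_value r
    have hrn : r ≤ n := by nlinarith
    rw [← mul_div_assoc, div_le_div_iff₀ (by positivity) hn', one_mul]
    calc (n : ℝ) ^ 2 * (r * n ^ r) * n ≤ (n : ℝ) ^ 2 * (n * n ^ r) * n := by gcongr
      _ = (n : ℝ) ^ (r + 4) := by ring
      _ ≤ (2 ^ l) ^ (r + 4) := by gcongr
      _ = 2 ^ (l * (r + 4)) := by rw [pow_mul]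
      _ ≤ 2 ^ n := pow_le_pow_right₀ one_le_two hlr
  have t3 : (n : ℝ) ^ 2 * (1 / 2 ^ (3 * l)) ≤ 1 / n := by
    calc (n : ℝ) ^ 2 * (1 / 2 ^ (3 * l)) = (n : ℝ) ^ 2 * (1 / (2 ^ l) ^ 3) := by
          rw [mul_comm 3, pow_mul]
      _ ≤ (n : ℝ) ^ 2 * (1 / (n : ℝ) ^ 3) := by gcongr
      _ = 1 / n := by field_simp
  have : (3 : ℝ) / n = 1 / n + 1 / n + 1 / n := by ring
  linarith

/-- Almost all graphs have a color refinement that is discrete after two rounds. -/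
lemma almostAllGraphs_neighborDegreesSeparate :
    AlmostAllGraphs fun _ G => NeighborDegreesSeparate G := by
  have hlim : Tendsto (fun n : ℕ => (3 : ℝ) / n) atTop (𝓝 0) :=
    tendsto_const_div_atTop_nhds_zero_nat 3
  refine squeeze_zero' (Eventually.of_forall fun n => by positivity) ?_ hlim
  filter_upwards [eventually_log_mul_sqrt_le] with n hn
  rw [div_le_iff₀ (by positivity)]
  refine (ncard_not_neighborDegreesSeparate_le_three_div hn).trans ?_
  gcongr
  exact_mod_cast card_simpleGraph_le n

lemma AlmostAllGraphs.mono_eventually {P Q : (n : ℕ) → SimpleGraph (Fin n) → Prop}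
    (hP : AlmostAllGraphs P) (h : ∀ᶠ n in atTop, ∀ G, P n G → Q n G) : AlmostAllGraphs Q := by
  refine squeeze_zero' (Eventually.of_forall fun n => by positivity) ?_ hP
  filter_upwards [h] with n hn
  gcongr
  · exact Set.toFinite _
  · exact fun hG => hn _ hG

end AlmostAll

end PRMPNN
end

open PRMPNN in
theorem theorem4p1 :
    (∀ k : ℕ, AlmostAllGraphs (fun _ G => k ≤ G.edgeSet.ncard)) ∧
    AlmostAllGraphs (fun n G =>
      ∀ ε : ℝ, 0 < ε → ε < 1 →
      ∀ k : ℕ, 0 < k → k ≤ G.edgeSet.ncard →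
      ∀ H : SimpleGraph (Fin n), Nonempty (G ≃g H) →
      ∀ d : ℕ, 0 < d →
      ∀ f : SimpleGraph (Fin n) → EuclideanSpace ℝ (Fin d), PermInvariant f → WLEquivalent f →
        ∃ m : ℕ, 0 < m ∧ ∃ U : UpstreamMPNN m,
          separationProb f G H
            (exactlyK G (U.priors G) k) (exactlyK H (U.priors H) k) ≤ ε ∧
          separationProb f G H
            (exactlyK ⊤ (U.priors G) k) (exactlyK ⊤ (U.priors H) k) ≤ ε) := by
  refine ⟨fun k => ?_, ?_⟩
  · refine almostAllGraphs_neighborDegreesSeparate.mono_eventually ?_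
    -- From `2k ≤ n ≤ 2|E(G)| + 1`, parity gives `k ≤ |E(G)|`.
    filter_upwards [eventually_ge_atTop (2 * k)] with n hn G hG
    have := card_le_of_neighborDegreesSeparate hG
    omega
  · refine almostAllGraphs_neighborDegreesSeparate.mono_eventually (Eventually.of_forall ?_)
    rintro n G hG ε hε - k - hk H ⟨σ⟩ d - f hf -
    exact ⟨1, one_pos, exists_mpnn_separationProb_le hε hG σ hk f hf⟩
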